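/- Let $R$ be a (commutative, Noetherian) Gorenstein local ring of Krull dimension one, and let $I\subseteq R$ be an ideal that contains a regular element (a nonzerodivisor of $R$) and is rigid, i.e. $\operatorname{Ext}^1_R(I,I)=0$. Let $\omega_{R/I}=\operatorname{Ext}^1_R(R/I,R)$ be the canonical module of $R/I$, and let $\lambda_R$ denote length of $R$-modules. (1) If $\lambda_R\big((I/I^2)\otimes_{R/I}\omega_{R/I}\big)\ \ge\ \lambda_R(R/I)$, then $\operatorname{End}_R(I)=R$ (that is, the homothety map $R\to\operatorname{End}_R(I)$ is bijective) and $I$ is a principal ideal. (2) If the $R/I$-module $\operatorname{Hom}_{R/I}(I/I^2,R/I)$ contains a free summand (a direct summand isomorphic to $R/I$), then likewise $\operatorname{End}_R(I)=R$ and $I$ is a principal ideal. -/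

import Mathlib

open scoped TensorProduct

universe u

/-- A commutative ring is a Gorenstein local ring if it is local, Noetherian, and has finite
injective dimension as a module over itself. -/
class IsGorensteinLocalRing (R : Type u) [CommRing R] : Prop
    extends IsLocalRing R, IsNoetherianRing R where
  exists_hasInjectiveDimensionLE :
    ∃ n : ℕ, CategoryTheory.HasInjectiveDimensionLE (ModuleCat.of R R) n

/-- An `R`-module `M` is rigid if `Ext¹_R(M, M) = 0`. -/
def IsRigidModule (R : Type u) [CommRing R] (M : Type u) [AddCommGroup M] [Module R M] : Prop :=
  Subsingleton (CategoryTheory.Abelian.Ext (ModuleCat.of R M) (ModuleCat.of R M) 1)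

/-- The `R ⧸ I`-module `Ext¹_R(R ⧸ I, R)`. When `R` is a one-dimensional Gorenstein local ring
and `I` contains a regular element, this is the canonical module `ω_{R/I}` of `R ⧸ I`. -/
def OmegaQuot {R : Type u} [CommRing R] (I : Ideal R) : Type u :=
  CategoryTheory.Abelian.Ext (ModuleCat.of R (R ⧸ I)) (ModuleCat.of R R) 1

namespace OmegaQuot

variable {R : Type u} [CommRing R] (I : Ideal R)

noncomputable instance : AddCommGroup (OmegaQuot I) :=
  inferInstanceAs (AddCommGroup
    (CategoryTheory.Abelian.Ext (ModuleCat.of R (R ⧸ I)) (ModuleCat.of R R) 1))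

noncomputable instance : Module R (OmegaQuot I) :=
  inferInstanceAs (Module R
    (CategoryTheory.Abelian.Ext (ModuleCat.of R (R ⧸ I)) (ModuleCat.of R R) 1))

/-- `Ext¹_R(R ⧸ I, R)` is annihilated by `I`. -/
theorem isTorsionBySet : Module.IsTorsionBySet R (OmegaQuot I) (I : Set R) := by
  rintro (e : CategoryTheory.Abelian.Ext (ModuleCat.of R (R ⧸ I)) (ModuleCat.of R R) 1) ⟨r, hr⟩
  change r • e = 0
  have h : r • CategoryTheory.CategoryStruct.id (ModuleCat.of R (R ⧸ I)) = 0 := by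
    refine ModuleCat.hom_ext (LinearMap.ext fun x => ?_)
    obtain ⟨y, rfl⟩ := Ideal.Quotient.mk_surjective x
    change r • Ideal.Quotient.mk I y = 0
    rw [← Ideal.Quotient.mk_eq_mk, ← Submodule.Quotient.mk_smul]
    exact (Submodule.Quotient.mk_eq_zero I).2 (I.mul_mem_right y hr)
  rw [← CategoryTheory.Abelian.Ext.mk₀_id_comp (r • e),
    CategoryTheory.Abelian.Ext.comp_smul, ← CategoryTheory.Abelian.Ext.smul_comp,
    ← CategoryTheory.Abelian.Ext.mk₀_smul, h]
  simp

/-- The induced `R ⧸ I`-module structure on `Ext¹_R(R ⧸ I, R)`. -/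
noncomputable instance : Module (R ⧸ I) (OmegaQuot I) :=
  (isTorsionBySet I).module

instance : IsScalarTower R (R ⧸ I) (OmegaQuot I) :=
  (isTorsionBySet I).isScalarTower

end OmegaQuot

/-- The twisted conormal module `(I/I²) ⊗_{R/I} ω_{R/I}`. -/
abbrev TwistedConormal {R : Type u} [CommRing R] (I : Ideal R) : Type u :=
  I.Cotangent ⊗[R ⧸ I] OmegaQuot I

/-- The `S`-module `M` has a direct summand isomorphic to `S`. For `S ≠ 0` this says
that `M` has a nonzero free direct summand. -/
def HasFreeSummand (S M : Type u) [CommRing S] [AddCommGroup M] [Module S M] : Prop :=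
  ∃ P N : Submodule S M, IsCompl P N ∧ Nonempty (P ≃ₗ[S] S)

/-!
`ω = Ext¹(R ⧸ I, R)` is a canonical module of the Artinian local ring `R ⧸ I`: for a regular
`x ∈ I` it is `Hom(R ⧸ I, R ⧸ x)` by Rees' lemma, and `R ⧸ x` is self-injective because `R` has
finite injective dimension. The connecting map `Hom(I, R) → ω` of `0 → I → R → R ⧸ I → 0` is
surjective, and its kernel consists of the multiplications by elements of `R`. Reduction modulo `I`
gives a map `Hom(I, R) → Hom(I ⧸ I², R ⧸ I)`, which kills these multiplications and is surjective
by rigidity. Hence `ω` maps onto `Hom(I ⧸ I², R ⧸ I)`, whose length is that of `(I ⧸ I²) ⊗ ω` by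
duality. Either hypothesis makes that length at least `λ(R ⧸ I) = λ(ω)`, so the two modules are
isomorphic. As `ω` has a simple socle, `I ⧸ I²` is then cyclic, and `I` is principal by Nakayama.
-/

section Length

variable {R M N P : Type*} [Ring R] [AddCommGroup M] [Module R M] [AddCommGroup N] [Module R N]
  [AddCommGroup P] [Module R P]

theorem bijective_of_injective_of_length_le {f : M →ₗ[R] N} (hf : Function.Injective f)
    (hN : IsFiniteLength R N) (hle : Module.length R N ≤ Module.length R M) :
    Function.Bijective f := by
  obtain ⟨_, _⟩ := isFiniteLength_iff_isNoetherian_isArtinian.1 hN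
  refine ⟨hf, LinearMap.range_eq_top.1 (by_contra fun h => ?_)⟩
  refine (Submodule.length_lt h).not_ge (hle.trans_eq ?_)
  exact (LinearEquiv.ofInjective f hf).length_eq

theorem bijective_of_surjective_of_length_le {f : M →ₗ[R] N} (hf : Function.Surjective f)
    (hM : IsFiniteLength R M) (hle : Module.length R M ≤ Module.length R N) :
    Function.Bijective f := by
  obtain ⟨_, _⟩ := isFiniteLength_iff_isNoetherian_isArtinian.1 hM
  refine ⟨LinearMap.ker_eq_bot.1 (by_contra fun h => ?_), hf⟩
  refine (Submodule.length_quotient_lt _ h).not_ge (hle.trans_eq ?_)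
  exact (f.quotKerEquivOfSurjective hf).length_eq.symm

theorem nonempty_linearEquiv_of_ker_le_of_length_le {f : M →ₗ[R] N} {g : M →ₗ[R] P}
    (hf : Function.Surjective f) (hg : Function.Surjective g)
    (hker : LinearMap.ker f ≤ LinearMap.ker g) (hN : IsFiniteLength R N)
    (hle : Module.length R N ≤ Module.length R P) : Nonempty (N ≃ₗ[R] P) := by
  have hlift : Function.Surjective ((LinearMap.ker f).liftQ g hker) := by
    rwa [← LinearMap.range_eq_top, Submodule.range_liftQ, LinearMap.range_eq_top]
  let h : N →ₗ[R] P := (LinearMap.ker f).liftQ g hker ∘ₗ (f.quotKerEquivOfSurjective hf).symm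
  have hh : Function.Surjective h := hlift.comp (f.quotKerEquivOfSurjective hf).symm.surjective
  exact ⟨LinearEquiv.ofBijective h (bijective_of_surjective_of_length_le hh hN hle)⟩

theorem isFiniteLength_restrictScalars {A B M : Type*} [CommRing A] [CommRing B] [Algebra A B]
    [AddCommGroup M] [Module A M] [Module B M] [IsScalarTower A B M]
    (hAB : Function.Surjective (algebraMap A B)) (hM : IsFiniteLength B M) :
    IsFiniteLength A M := by
  rwa [← Module.length_ne_top_iff, Module.length_eq_of_surjective hAB, Module.length_ne_top_iff]

end Length

section InjectiveModules

open IsLocalRing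

variable {A : Type u} [CommRing A] [IsLocalRing A] {E M : Type u} [AddCommGroup E] [Module A E]
  [AddCommGroup M] [Module A M]

theorem nonempty_linearEquiv_residueField [IsSimpleModule A M] :
    Nonempty (M ≃ₗ[A] ResidueField A) := by
  obtain ⟨m, hm, ⟨e⟩⟩ := isSimpleModule_iff_quot_maximal.1 ‹IsSimpleModule A M›
  obtain rfl := eq_maximalIdeal hm
  exact ⟨e⟩

theorem exists_injective_residueField [IsArtinian A M] [Nontrivial M] :
    ∃ f : ResidueField A →ₗ[A] M, Function.Injective f := by
  obtain ⟨N, hN⟩ := IsAtomic.exists_atom (Submodule A M)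
  have := isSimpleModule_iff_isAtom.2 hN
  obtain ⟨e⟩ := nonempty_linearEquiv_residueField (A := A) (M := N)
  exact ⟨N.subtype ∘ₗ e.symm, N.subtype_injective.comp e.symm.injective⟩

theorem length_linearMap_of_injective [Module.Injective A E] (hM : IsFiniteLength A M) :
    Module.length A (M →ₗ[A] E) =
      Module.length A (ResidueField A →ₗ[A] E) * Module.length A M := by
  induction hM with
  | of_subsingleton => simp
  | @of_simple_quotient M _ _ N _ _ ih =>
    obtain ⟨e⟩ := nonempty_linearEquiv_residueField (A := A) (M := M ⧸ N)
    have hexact := LinearMap.exact_subtype_mkQ N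
    have hsurj : Function.Surjective (LinearMap.lcomp A E N.subtype) := fun f =>
      Module.Injective.extension_property A E N M N.subtype N.subtype_injective f
    rw [Module.length_eq_add_of_exact (LinearMap.lcomp A E N.mkQ) (LinearMap.lcomp A E N.subtype)
        (LinearMap.lcomp_injective_of_surjective _ N.mkQ_surjective) hsurj
        (LinearMap.exact_lcomp_of_exact_of_surjective E hexact N.mkQ_surjective), ih,
      Module.length_eq_add_of_exact N.subtype N.mkQ N.subtype_injective N.mkQ_surjective hexact,
      Module.length_eq_one A (M ⧸ N), (e.congrLeft E A).length_eq, mul_add, mul_one, add_comm]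

theorem length_le_length_linearMap_residueField {W : Type u} [AddCommGroup W] [Module A W]
    [Module (ResidueField A) W] [IsScalarTower A (ResidueField A) W] {f : W →ₗ[A] E}
    (hf : Function.Injective f) :
    Module.length A W ≤ Module.length A (ResidueField A →ₗ[A] E) := by
  let F : W →ₗ[A] ResidueField A →ₗ[A] E :=
    ((LinearMap.lsmul (ResidueField A) W).restrictScalars₁₂ A A).flip.compr₂ f
  refine Module.length_le_of_injective F fun w w' h => hf ?_
  simpa [F] using LinearMap.congr_fun h 1

end InjectiveModules

theorem isFiniteLength_of_finite (A M : Type*) [Ring A] [IsArtinianRing A] [AddCommGroup M]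
    [Module A M] [Module.Finite A M] : IsFiniteLength A M :=
  isFiniteLength_iff_isNoetherian_isArtinian.2 ⟨inferInstance, inferInstance⟩

theorem injective_of_linearEquiv_linearMap {A B E ω : Type u} [CommRing A] [CommRing B]
    [Algebra A B] [AddCommGroup E] [Module A E] [AddCommGroup ω] [Module A ω] [Module B ω]
    [IsScalarTower A B ω] (hE : Module.Injective A E) (hAB : Function.Surjective (algebraMap A B))
    (e : (B →ₗ[A] E) ≃ₗ[A] ω) : Module.Injective B ω := by
  refine Module.Baer.injective fun J g => ?_
  let f : J →ₗ[A] E := LinearMap.applyₗ (1 : B) ∘ₗ e.symm.toLinearMap ∘ₗ g.restrictScalars A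
  obtain ⟨F, hF⟩ := hE.extension_property A E J B (J.subtype.restrictScalars A)
    J.subtype_injective f
  refine ⟨LinearMap.toSpanSingleton B ω (e F), fun b hb => ?_⟩
  obtain ⟨a, rfl⟩ := hAB b
  suffices a • F = e.symm (g ⟨algebraMap A B a, hb⟩) by
    rw [LinearMap.toSpanSingleton_apply, algebraMap_smul, ← map_smul, this, e.apply_symm_apply]
  ext c
  obtain ⟨d, rfl⟩ := hAB c
  let j : J := ⟨algebraMap A B a, hb⟩
  have hj : a • algebraMap A B d = d • (j : B) := by
    rw [Algebra.smul_def, Algebra.smul_def, mul_comm]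
  calc (a • F) (algebraMap A B d) = d • F j := by
        rw [LinearMap.smul_apply, ← map_smul, hj, map_smul]
    _ = d • e.symm (g j) 1 := congrArg (d • ·) (LinearMap.congr_fun hF j)
    _ = e.symm (g j) (algebraMap A B d) := by rw [← map_smul, Algebra.algebraMap_eq_smul_one]

/-- A canonical module of an Artinian local ring `A`, that is, an injective hull of its residue
field, encoded as an injective module of the same length as `A`. -/
structure IsCanonicalModule (A ω : Type u) [CommRing A] [AddCommGroup ω] [Module A ω] : Prop where
  injective : Module.Injective A ω
  length_eq : Module.length A ω = Module.length A A

namespace IsCanonicalModule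

open IsLocalRing

variable {A : Type u} [CommRing A] [IsArtinianRing A] {ω : Type u} [AddCommGroup ω] [Module A ω]

theorem isFiniteLength (h : IsCanonicalModule A ω) : IsFiniteLength A ω := by
  rw [← Module.length_ne_top_iff, h.length_eq, Module.length_ne_top_iff]
  exact (isArtinianRing_iff_isFiniteLength A).1 inferInstance

variable [IsLocalRing A]

theorem length_residueField (h : IsCanonicalModule A ω) :
    Module.length A (ResidueField A →ₗ[A] ω) = 1 := by
  have := h.injective
  have hA : IsFiniteLength A A := (isArtinianRing_iff_isFiniteLength A).1 inferInstance
  have hmul : 1 * Module.length A A =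
      Module.length A (ResidueField A →ₗ[A] ω) * Module.length A A := by
    rw [one_mul, ← length_linearMap_of_injective hA, ← h.length_eq]
    exact (LinearMap.ringLmapEquivSelf A A ω).length_eq.symm
  exact (ENat.mul_left_strictMono Module.length_pos.ne' (Module.length_ne_top_iff.2 hA)).injective
    hmul.symm

theorem length_linearMap (h : IsCanonicalModule A ω) {M : Type u} [AddCommGroup M] [Module A M]
    (hM : IsFiniteLength A M) : Module.length A (M →ₗ[A] ω) = Module.length A M := by
  have := h.injective
  rw [length_linearMap_of_injective hM, h.length_residueField, one_mul]

theorem annihilator_eq_bot (h : IsCanonicalModule A ω) : Module.annihilator A ω = ⊥ := by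
  have := h.injective
  let J := Module.annihilator A ω
  -- Restriction `Hom(A, ω) → Hom(J, ω)` is both surjective and zero.
  have hzero (f : J →ₗ[A] ω) : f = 0 := by
    obtain ⟨g, rfl⟩ := Module.Injective.extension_property A ω J A J.subtype J.subtype_injective f
    ext a
    rw [LinearMap.comp_apply, J.subtype_apply, ← mul_one (a : A), ← smul_eq_mul, map_smul,
      Module.mem_annihilator.1 a.2, LinearMap.zero_apply]
  have : Subsingleton (J →ₗ[A] ω) := ⟨fun f g => (hzero f).trans (hzero g).symm⟩
  have hJ := h.length_linearMap (isFiniteLength_of_finite A J)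
  rw [Module.length_eq_zero, eq_comm, Module.length_eq_zero_iff] at hJ
  exact J.subsingleton_iff_eq_bot.1 hJ

theorem bijective_algebraMap_end (h : IsCanonicalModule A ω) :
    Function.Bijective (algebraMap A (Module.End A ω)) := by
  have hlen := h.length_linearMap h.isFiniteLength
  refine bijective_of_injective_of_length_le (f := Algebra.linearMap A (Module.End A ω))
    (LinearMap.ker_eq_bot.1 ?_) ?_ (hlen.trans h.length_eq).le
  · refine (Submodule.eq_bot_iff _).2 fun a ha => ?_
    rw [← Ideal.mem_bot, ← h.annihilator_eq_bot, Module.mem_annihilator]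
    exact LinearMap.congr_fun ha
  · rw [← Module.length_ne_top_iff, hlen, Module.length_ne_top_iff]
    exact h.isFiniteLength

theorem length_linearMap_self (h : IsCanonicalModule A ω) (C : Type u)
    [AddCommGroup C] [Module A C] [Module.Finite A C] :
    Module.length A (C →ₗ[A] A) = Module.length A (C ⊗[A] ω) := by
  obtain ⟨_, _⟩ := isFiniteLength_iff_isNoetherian_isArtinian.1 h.isFiniteLength
  let homothety : A ≃ₗ[A] Module.End A ω :=
    LinearEquiv.ofBijective (Algebra.linearMap A _) h.bijective_algebraMap_end
  let adjunction : (C →ₗ[A] A) ≃ₗ[A] (C ⊗[A] ω →ₗ[A] ω) :=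
    homothety.congrRight ≪≫ₗ TensorProduct.lift.equiv (RingHom.id A) C ω ω
  rw [adjunction.length_eq, h.length_linearMap (isFiniteLength_of_finite A _)]

section

variable {B E : Type u} [CommRing B] [Algebra A B] [AddCommGroup E] [Module A E] [Module B ω]
  [IsScalarTower A B ω]

theorem of_surjective (h : IsCanonicalModule A E) (hAB : Function.Surjective (algebraMap A B))
    (e : (B →ₗ[A] E) ≃ₗ[A] ω) : IsCanonicalModule B ω where
  injective := injective_of_linearEquiv_linearMap h.injective hAB e
  length_eq := by
    have : Module.Finite A B := Module.Finite.of_surjective (Algebra.linearMap A B) hAB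
    rw [← Module.length_eq_of_surjective hAB, ← Module.length_eq_of_surjective hAB, ← e.length_eq,
      h.length_linearMap (isFiniteLength_of_finite A B)]

end

end IsCanonicalModule

section CyclicModules

open IsLocalRing

theorem isPrincipal_top_of_finrank_residueField_tensorProduct_le_one {A C : Type u} [CommRing A]
    [IsLocalRing A] [AddCommGroup C] [Module A C] [Module.Finite A C]
    (h : Module.finrank (ResidueField A) (ResidueField A ⊗[A] C) ≤ 1) :
    (⊤ : Submodule A C).IsPrincipal := by
  have hrank : (⊤ : Submodule A C).spanFinrank ≤ 1 := by
    let e : ResidueField A ⊗[A] (⊤ : Submodule A C) ≃ₗ[ResidueField A] ResidueField A ⊗[A] C :=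
      Submodule.topEquiv.baseChange A (ResidueField A) _ _
    rwa [← TensorProduct.spanFinrank_top_eq_of_residueField _ Module.Finite.fg_top,
      ← Module.finrank_eq_spanFinrank_of_free, e.finrank_eq]
  rcases Nat.le_one_iff_eq_zero_or_eq_one.1 hrank with h0 | h1
  · rw [(Submodule.spanFinrank_eq_zero_iff_eq_bot Module.Finite.fg_top).1 h0]
    infer_instance
  · exact ((Submodule.spanFinrank_eq_one_iff _).1 h1).1

theorem IsCanonicalModule.isPrincipal_top_of_injective {A ω C : Type u} [CommRing A] [IsLocalRing A]
    [IsArtinianRing A] [AddCommGroup ω] [Module A ω] (h : IsCanonicalModule A ω) [AddCommGroup C]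
    [Module A C] [Module.Finite A C] {f : (C →ₗ[A] A) →ₗ[A] ω} (hf : Function.Injective f) :
    (⊤ : Submodule A C).IsPrincipal := by
  refine isPrincipal_top_of_finrank_residueField_tensorProduct_le_one ?_
  obtain ⟨ι, hι⟩ := exists_injective_residueField (A := A) (M := A)
  -- `Hom(C, k)` embeds into the socle of `ω`, which is one-dimensional.
  have hsocle : Module.length A (C →ₗ[A] ResidueField A) ≤ 1 := by
    rw [← h.length_residueField]
    refine length_le_length_linearMap_residueField (f := f ∘ₗ LinearMap.compRight A ι)
      (hf.comp fun φ ψ hφψ => ?_)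
    exact LinearMap.ext fun c => hι (LinearMap.congr_fun hφψ c)
  rw [Module.length_eq_of_surjective residue_surjective,
    (LinearMap.liftBaseChangeEquiv (ResidueField A)).length_eq, Module.length_eq_finrank,
    Subspace.dual_finrank_eq] at hsocle
  exact_mod_cast hsocle

theorem isPrincipal_of_isPrincipal_top_cotangent {R : Type u} [CommRing R] [IsLocalRing R]
    {I : Ideal R} (hfg : I.FG) (hI : I ≠ ⊤) (h : (⊤ : Submodule (R ⧸ I) I.Cotangent).IsPrincipal) :
    I.IsPrincipal := by
  obtain ⟨c, hc⟩ := h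
  obtain ⟨y, rfl⟩ := I.toCotangent_surjective c
  have hmap : (R ∙ y).map I.toCotangent = ⊤ := by
    rw [Submodule.map_span, Set.image_singleton,
      ← Submodule.restrictScalars_span R (R ⧸ I) Ideal.Quotient.mk_surjective, ← hc,
      Submodule.restrictScalars_top]
  have hsup : (⊤ : Submodule R I) ≤ (R ∙ y) ⊔ I • ⊤ := by
    have hker : LinearMap.ker I.toCotangent = I • ⊤ := Submodule.ker_mkQ _
    rw [← hker, ← Submodule.comap_map_eq, hmap, Submodule.comap_top]
  have hy : (⊤ : Submodule R I) ≤ R ∙ y :=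
    Submodule.le_of_le_smul_of_le_jacobson_bot ((Submodule.fg_top I).2 hfg)
      ((le_maximalIdeal hI).trans (maximalIdeal_le_jacobson _)) hsup
  have hspan : I = (R ∙ y).map I.subtype := by
    rw [top_le_iff.1 hy, Submodule.map_top, Submodule.range_subtype]
  rw [Submodule.map_span, Set.image_singleton] at hspan
  exact ⟨⟨y, hspan⟩⟩

end CyclicModules

section Ext

open CategoryTheory CategoryTheory.Abelian IsLocalRing

variable {R : Type u} [CommRing R]

section ExactSequences

variable {M₁ M₂ M₃ : Type u} [AddCommGroup M₁] [Module R M₁] [AddCommGroup M₂] [Module R M₂]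
  [AddCommGroup M₃] [Module R M₃] {f : M₁ →ₗ[R] M₂} {g : M₂ →ₗ[R] M₃}

/-- The short complex of modules attached to an exact pair of linear maps. -/
noncomputable abbrev moduleShortComplex (h : Function.Exact f g) : ShortComplex (ModuleCat.{u} R) :=
  ModuleCat.shortComplexOfCompEqZero f g h.linearMap_comp_eq_zero

theorem moduleShortComplex_shortExact (h : Function.Exact f g) (hf : Function.Injective f)
    (hg : Function.Surjective g) : (moduleShortComplex h).ShortExact :=
  ModuleCat.shortComplex_shortExact _ h hf hg

variable (h : Function.Exact f g) (hf : Function.Injective f) (hg : Function.Surjective g)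

include h hf hg

theorem subsingleton_ext_of_exact₁ {N : ModuleCat.{u} R} {n : ℕ}
    (h₂ : Subsingleton (Ext (ModuleCat.of R M₂) N n))
    (h₃ : Subsingleton (Ext (ModuleCat.of R M₃) N (n + 1))) :
    Subsingleton (Ext (ModuleCat.of R M₁) N n) := by
  refine subsingleton_of_forall_eq 0 fun e => ?_
  obtain ⟨d, rfl⟩ := Ext.contravariant_sequence_exact₁ (moduleShortComplex_shortExact h hf hg) N e
    (add_comm 1 n) (h₃.elim _ _)
  rw [h₂.elim d 0, Ext.comp_zero]

theorem subsingleton_ext_of_exact₂ {N : ModuleCat.{u} R} {n : ℕ}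
    (h₁ : Subsingleton (Ext (ModuleCat.of R M₁) N n))
    (h₃ : Subsingleton (Ext (ModuleCat.of R M₃) N n)) :
    Subsingleton (Ext (ModuleCat.of R M₂) N n) := by
  refine subsingleton_of_forall_eq 0 fun e => ?_
  obtain ⟨d, rfl⟩ := Ext.contravariant_sequence_exact₂ (moduleShortComplex_shortExact h hf hg) N e
    (h₁.elim _ _)
  rw [h₃.elim d 0, Ext.comp_zero]

theorem subsingleton_ext_of_exact₃ {N : ModuleCat.{u} R} {n : ℕ}
    (h₁ : Subsingleton (Ext (ModuleCat.of R M₁) N n))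
    (h₂ : Subsingleton (Ext (ModuleCat.of R M₂) N (n + 1))) :
    Subsingleton (Ext (ModuleCat.of R M₃) N (n + 1)) := by
  refine subsingleton_of_forall_eq 0 fun e => ?_
  obtain ⟨d, rfl⟩ := Ext.contravariant_sequence_exact₃ (moduleShortComplex_shortExact h hf hg) N e
    (h₂.elim _ _) (add_comm 1 n)
  rw [h₁.elim d 0, Ext.comp_zero]

/-- The connecting homomorphism `Hom(M, M₃) → Ext¹(M, M₁)` of a short exact sequence
`0 → M₁ → M₂ → M₃ → 0`. -/
noncomputable def covariantConnecting (M : Type u) [AddCommGroup M] [Module R M] :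
    (M →ₗ[R] M₃) →ₗ[R] Ext (ModuleCat.of R M) (ModuleCat.of R M₁) 1 where
  toFun φ := (Ext.mk₀ (ModuleCat.ofHom φ)).comp
    (moduleShortComplex_shortExact h hf hg).extClass (zero_add 1)
  map_add' φ ψ := by rw [ModuleCat.ofHom_add, Ext.mk₀_add, Ext.add_comp]
  map_smul' r φ := by
    rw [← Ext.smul_comp, ← Ext.mk₀_smul]
    rfl

/-- The connecting homomorphism `Hom(M₁, N) → Ext¹(M₃, N)` of a short exact sequence
`0 → M₁ → M₂ → M₃ → 0`. -/
noncomputable def contravariantConnecting (N : Type u) [AddCommGroup N] [Module R N] :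
    (M₁ →ₗ[R] N) →ₗ[R] Ext (ModuleCat.of R M₃) (ModuleCat.of R N) 1 where
  toFun φ := (moduleShortComplex_shortExact h hf hg).extClass.comp
    (Ext.mk₀ (ModuleCat.ofHom φ)) (add_zero 1)
  map_add' φ ψ := by rw [ModuleCat.ofHom_add, Ext.mk₀_add, Ext.comp_add]
  map_smul' r φ := by
    rw [← Ext.comp_smul, ← Ext.mk₀_smul]
    rfl

variable {h hf hg}

theorem exists_comp_eq_of_covariantConnecting_eq_zero {M : Type u} [AddCommGroup M] [Module R M]
    {φ : M →ₗ[R] M₃} (hφ : covariantConnecting h hf hg M φ = 0) :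
    ∃ ψ : M →ₗ[R] M₂, g ∘ₗ ψ = φ := by
  obtain ⟨e, he⟩ := Ext.covariant_sequence_exact₃ _ (moduleShortComplex_shortExact h hf hg)
    (Ext.mk₀ (ModuleCat.ofHom φ)) (zero_add 1) hφ
  obtain ⟨ψ, rfl⟩ := (Ext.mk₀_bijective _ _).2 e
  rw [Ext.mk₀_comp_mk₀] at he
  exact ⟨ψ.hom, congrArg ModuleCat.Hom.hom ((Ext.mk₀_bijective _ _).1 he)⟩

theorem exists_comp_eq_of_contravariantConnecting_eq_zero {N : Type u} [AddCommGroup N] [Module R N]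
    {φ : M₁ →ₗ[R] N} (hφ : contravariantConnecting h hf hg N φ = 0) :
    ∃ ψ : M₂ →ₗ[R] N, ψ ∘ₗ f = φ := by
  obtain ⟨e, he⟩ := Ext.contravariant_sequence_exact₁ (moduleShortComplex_shortExact h hf hg) _
    (Ext.mk₀ (ModuleCat.ofHom φ)) (add_zero 1) hφ
  obtain ⟨ψ, rfl⟩ := (Ext.mk₀_bijective _ _).2 e
  rw [Ext.mk₀_comp_mk₀] at he
  exact ⟨ψ.hom, congrArg ModuleCat.Hom.hom ((Ext.mk₀_bijective _ _).1 he)⟩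

theorem exists_covariantConnecting_eq {M : Type u} [AddCommGroup M] [Module R M]
    {e : Ext (ModuleCat.of R M) (ModuleCat.of R M₁) 1}
    (he : e.comp (Ext.mk₀ (ModuleCat.ofHom f)) (add_zero 1) = 0) :
    ∃ φ, covariantConnecting h hf hg M φ = e := by
  obtain ⟨d, hd⟩ := Ext.covariant_sequence_exact₁ _ (moduleShortComplex_shortExact h hf hg) e he
    (zero_add 1)
  obtain ⟨φ, rfl⟩ := (Ext.mk₀_bijective _ _).2 d
  exact ⟨φ.hom, hd⟩

theorem surjective_contravariantConnecting (N : Type u) [AddCommGroup N] [Module R N]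
    [Module.Projective R M₂] : Function.Surjective (contravariantConnecting h hf hg N) := by
  intro e
  obtain ⟨d, hd⟩ := Ext.contravariant_sequence_exact₃ (moduleShortComplex_shortExact h hf hg) _ e
    (Ext.eq_zero_of_projective _) (add_zero 1)
  obtain ⟨φ, rfl⟩ := (Ext.mk₀_bijective _ _).2 d
  exact ⟨φ.hom, hd⟩

variable (h hf hg) in
theorem exists_comp_eq_of_subsingleton_ext {M : Type u} [AddCommGroup M] [Module R M]
    (hM : Subsingleton (Ext (ModuleCat.of R M) (ModuleCat.of R M₁) 1)) (φ : M →ₗ[R] M₃) :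
    ∃ ψ : M →ₗ[R] M₂, g ∘ₗ ψ = φ :=
  exists_comp_eq_of_covariantConnecting_eq_zero (h := h) (hf := hf) (hg := hg) (hM.elim _ _)

end ExactSequences

section Vanishing

theorem subsingleton_ext_of_subsingleton (M : Type u) [AddCommGroup M] [Module R M]
    [Subsingleton M] (N : ModuleCat.{u} R) (n : ℕ) :
    Subsingleton (Ext (ModuleCat.of R M) N n) := by
  refine subsingleton_of_forall_eq 0 fun e => ?_
  have hid : 𝟙 (ModuleCat.of R M) = 0 := (ModuleCat.isZero_of_subsingleton _).eq_of_src _ _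
  rw [← Ext.mk₀_id_comp e, hid, Ext.mk₀_zero, Ext.zero_comp]

variable [IsLocalRing R] {N : ModuleCat.{u} R}

theorem subsingleton_ext_of_isFiniteLength {n : ℕ}
    (hk : Subsingleton (Ext (ModuleCat.of R (ResidueField R)) N n)) {M : Type u} [AddCommGroup M]
    [Module R M] (hM : IsFiniteLength R M) : Subsingleton (Ext (ModuleCat.of R M) N n) := by
  induction hM with
  | of_subsingleton => exact subsingleton_ext_of_subsingleton _ N n
  | @of_simple_quotient M _ _ L _ _ ih =>
    obtain ⟨e⟩ := nonempty_linearEquiv_residueField (A := R) (M := M ⧸ L)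
    have hexact : Function.Exact L.subtype (e.toLinearMap ∘ₗ L.mkQ) := fun m => by simp
    exact subsingleton_ext_of_exact₂ hexact L.subtype_injective
      (e.surjective.comp L.mkQ_surjective) ih hk

theorem subsingleton_ext_of_isFiniteLength_of_forall_ge {n m : ℕ} [HasInjectiveDimensionLT N n]
    {Q : Type u} [AddCommGroup Q] [Module R Q] [Nontrivial Q] (hQ : IsFiniteLength R Q)
    (hQN : ∀ i ≥ m, Subsingleton (Ext (ModuleCat.of R Q) N i)) {M : Type u} [AddCommGroup M]
    [Module R M] (hM : IsFiniteLength R M) : Subsingleton (Ext (ModuleCat.of R M) N m) := by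
  obtain ⟨_, _⟩ := isFiniteLength_iff_isNoetherian_isArtinian.1 hQ
  obtain ⟨ι, hι⟩ := exists_injective_residueField (A := R) (M := Q)
  -- Descending induction on the degree: `Extⁱ(k, N)` sits between `Extⁱ(Q, N)` and
  -- `Extⁱ⁺¹(Q / k, N)`.
  suffices ∀ j i, m ≤ i → n ≤ i + j → ∀ {M : Type u} [AddCommGroup M] [Module R M],
      IsFiniteLength R M → Subsingleton (Ext (ModuleCat.of R M) N i) from
    this n m le_rfl (Nat.le_add_left n m) hM
  intro j
  induction j with
  | zero => exact fun i _ hi _ _ _ _ => HasInjectiveDimensionLT.subsingleton N n i hi _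
  | succ j ih =>
    intro i hi hj M _ _ hM
    refine subsingleton_ext_of_isFiniteLength ?_ hM
    refine subsingleton_ext_of_exact₁ (LinearMap.exact_map_mkQ_range ι) hι
      (Submodule.mkQ_surjective _) (hQN i hi) (ih (i + 1) (by lia) (by lia) ?_)
    exact isFiniteLength_iff_isNoetherian_isArtinian.2 ⟨inferInstance, inferInstance⟩

end Vanishing

section Rees

variable {x : R}

theorem exact_mul_mkQ (x : R) :
    Function.Exact (LinearMap.lsmul R R x) (Ideal.span {x}).mkQ := by
  intro y
  rw [Submodule.mkQ_apply, Submodule.Quotient.mk_eq_zero, Ideal.mem_span_singleton', Set.mem_range]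
  simp only [LinearMap.lsmul_apply, smul_eq_mul, mul_comm]

theorem injective_lsmul_of_mem_nonZeroDivisors (hx : x ∈ nonZeroDivisors R) :
    Function.Injective (LinearMap.lsmul R R x) :=
  fun _ _ => (mul_cancel_left_mem_nonZeroDivisors hx).1

theorem subsingleton_ext_quotient_span_singleton (hx : x ∈ nonZeroDivisors R) (N : ModuleCat.{u} R)
    {n : ℕ} (hn : 2 ≤ n) : Subsingleton (Ext (ModuleCat.of R (R ⧸ Ideal.span {x})) N n) := by
  obtain ⟨n, rfl⟩ := Nat.exists_eq_add_of_le' hn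
  exact subsingleton_ext_of_exact₃ (exact_mul_mkQ x) (injective_lsmul_of_mem_nonZeroDivisors hx)
    (Submodule.mkQ_surjective _) (Ext.subsingleton_of_projective ..)
    (Ext.subsingleton_of_projective ..)

/-- The connecting homomorphism `Hom(M, R/x) → Ext¹(M, R)` of `0 → R → R → R/x → 0`, which is an
isomorphism when `x` kills `M` (Rees). -/
noncomputable def reesHom (hx : x ∈ nonZeroDivisors R) (M : Type u) [AddCommGroup M] [Module R M] :
    (M →ₗ[R] R ⧸ Ideal.span {x}) →ₗ[R] Ext (ModuleCat.of R M) (ModuleCat.of R R) 1 :=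
  covariantConnecting (exact_mul_mkQ x) (injective_lsmul_of_mem_nonZeroDivisors hx)
    (Submodule.mkQ_surjective _) M

theorem reesHom_comp (hx : x ∈ nonZeroDivisors R) {M N : Type u} [AddCommGroup M] [Module R M]
    [AddCommGroup N] [Module R N] (f : N →ₗ[R] R ⧸ Ideal.span {x}) (i : M →ₗ[R] N) :
    reesHom hx M (f ∘ₗ i) =
      (Ext.mk₀ (ModuleCat.ofHom i)).comp (reesHom hx N f) (zero_add 1) := by
  simp [reesHom, covariantConnecting, ModuleCat.ofHom_comp]

theorem bijective_reesHom (hx : x ∈ nonZeroDivisors R) {M : Type u} [AddCommGroup M] [Module R M]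
    (hM : ∀ m : M, x • m = 0) : Function.Bijective (reesHom hx M) := by
  constructor
  · refine (injective_iff_map_eq_zero _).2 fun φ hφ => ?_
    obtain ⟨ψ, rfl⟩ := exists_comp_eq_of_covariantConnecting_eq_zero hφ
    have hψ : ψ = 0 := LinearMap.ext fun m => injective_lsmul_of_mem_nonZeroDivisors hx <| by
      rw [LinearMap.lsmul_apply, ← map_smul, hM, map_zero, LinearMap.zero_apply, map_zero]
    rw [hψ, LinearMap.comp_zero]
  · intro e
    refine exists_covariantConnecting_eq ?_
    have hx_id : x • 𝟙 (ModuleCat.of R M) = 0 := ModuleCat.hom_ext (LinearMap.ext hM)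
    have hsmul : e.comp (Ext.mk₀ (ModuleCat.ofHom (LinearMap.lsmul R R x))) (add_zero 1) = x • e :=
      (Ext.smul_eq_comp_mk₀ e x).symm
    rw [hsmul, ← Ext.mk₀_id_comp (x • e), Ext.comp_smul, ← Ext.smul_comp, ← Ext.mk₀_smul, hx_id,
      Ext.mk₀_zero, Ext.zero_comp]

theorem exists_comp_eq_of_subsingleton_ext_two (hx : x ∈ nonZeroDivisors R) {M₁ M₂ M₃ : Type u}
    [AddCommGroup M₁] [Module R M₁] [AddCommGroup M₂] [Module R M₂] [AddCommGroup M₃] [Module R M₃]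
    {f : M₁ →ₗ[R] M₂} {g : M₂ →ₗ[R] M₃} (h : Function.Exact f g) (hf : Function.Injective f)
    (hg : Function.Surjective g) (hM₂ : ∀ m : M₂, x • m = 0)
    (hM₃ : Subsingleton (Ext (ModuleCat.of R M₃) (ModuleCat.of R R) 2))
    (φ : M₁ →ₗ[R] R ⧸ Ideal.span {x}) : ∃ ψ : M₂ →ₗ[R] R ⧸ Ideal.span {x}, ψ ∘ₗ f = φ := by
  have hM₁ (m : M₁) : x • m = 0 := hf (by rw [map_smul, hM₂, map_zero])
  obtain ⟨e, he⟩ := Ext.contravariant_sequence_exact₁ (moduleShortComplex_shortExact h hf hg) _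
    (reesHom hx M₁ φ) one_add_one_eq_two (hM₃.elim _ _)
  obtain ⟨ψ, rfl⟩ := (bijective_reesHom hx hM₂).2 e
  exact ⟨ψ, (bijective_reesHom hx hM₁).1 ((reesHom_comp hx ψ f).trans he)⟩

end Rees

end Ext

section OneDimensional

open CategoryTheory

variable {R : Type u} [CommRing R]

theorem isArtinianRing_quotient_span_singleton [IsNoetherianRing R] (hdim : ringKrullDim R ≤ 1)
    {x : R} (hx : x ∈ nonZeroDivisors R) : IsArtinianRing (R ⧸ Ideal.span {x}) := by
  rw [isArtinianRing_iff_krullDimLE_zero, Ring.KrullDimLE, Order.krullDimLE_iff]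
  have h : ringKrullDim (R ⧸ Ideal.span {x}) + 1 ≤ 0 + 1 :=
    (ringKrullDim_quotient_succ_le_of_nonZeroDivisor hx).trans (by simpa using hdim)
  exact ENat.WithBot.add_le_add_one_right_iff.1 h

theorem smul_quotient_eq_zero_of_mem {I : Ideal R} {x : R} (hx : x ∈ I) (a : R ⧸ I) :
    x • a = 0 := by
  rw [Algebra.smul_def, Ideal.Quotient.algebraMap_eq, Ideal.Quotient.eq_zero_iff_mem.2 hx, zero_mul]

variable [IsLocalRing R] {x : R}

theorem injective_quotient_span_singleton {n : ℕ} [HasInjectiveDimensionLT (ModuleCat.of R R) n]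
    (hx : x ∈ nonZeroDivisors R) [IsArtinianRing (R ⧸ Ideal.span {x})] :
    Module.Injective (R ⧸ Ideal.span {x}) (R ⧸ Ideal.span {x}) := by
  refine Module.Baer.injective fun J φ => ?_
  cases subsingleton_or_nontrivial (R ⧸ Ideal.span {x})
  · exact ⟨0, fun _ _ => Subsingleton.elim _ _⟩
  have hfin (M : Type u) [AddCommGroup M] [Module R M] [Module (R ⧸ Ideal.span {x}) M]
      [IsScalarTower R (R ⧸ Ideal.span {x}) M] [Module.Finite (R ⧸ Ideal.span {x}) M] :
      IsFiniteLength R M :=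
    isFiniteLength_restrictScalars Ideal.Quotient.mk_surjective
      (isFiniteLength_of_finite (R ⧸ Ideal.span {x}) M)
  have hext := subsingleton_ext_of_isFiniteLength_of_forall_ge (n := n) (hfin (R ⧸ Ideal.span {x}))
    (fun i => subsingleton_ext_quotient_span_singleton hx (ModuleCat.of R R))
    (hfin ((R ⧸ Ideal.span {x}) ⧸ J))
  have hexact : Function.Exact (J.subtype.restrictScalars R) (J.mkQ.restrictScalars R) :=
    LinearMap.exact_subtype_mkQ J
  obtain ⟨ψ, hψ⟩ := exists_comp_eq_of_subsingleton_ext_two hx hexact J.subtype_injective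
    J.mkQ_surjective (smul_quotient_eq_zero_of_mem (Ideal.mem_span_singleton_self x)) hext
    (φ.restrictScalars R)
  exact ⟨ψ.extendScalarsOfSurjective Ideal.Quotient.mk_surjective,
    fun a ha => LinearMap.congr_fun hψ ⟨a, ha⟩⟩

theorem isCanonicalModule_omegaQuot {n : ℕ} [HasInjectiveDimensionLT (ModuleCat.of R R) n]
    (hx : x ∈ nonZeroDivisors R) [IsArtinianRing (R ⧸ Ideal.span {x})] {I : Ideal R}
    (hxI : x ∈ I) (hI : I ≠ ⊤) : IsCanonicalModule (R ⧸ I) (OmegaQuot I) := by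
  let A := R ⧸ Ideal.span {x}
  have hle : Ideal.span {x} ≤ I := (Ideal.span_singleton_le_iff_mem I).2 hxI
  let f : A →+* R ⧸ I := Ideal.Quotient.factor hle
  let _ : Algebra A (R ⧸ I) := f.toAlgebra
  let _ : Module A (OmegaQuot I) := Module.compHom _ f
  have : IsScalarTower A (R ⧸ I) (OmegaQuot I) := ⟨fun _ b ω => mul_smul _ b ω⟩
  have : IsScalarTower R A (OmegaQuot I) :=
    ⟨fun r a w => by
      obtain ⟨b, rfl⟩ := Ideal.Quotient.mk_surjective a
      exact smul_assoc r (Ideal.Quotient.mk I b) w⟩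
  have : IsScalarTower R A (R ⧸ I) := IsScalarTower.of_algebraMap_eq fun _ => rfl
  have : Nontrivial A := Ideal.Quotient.nontrivial_iff.2 (ne_top_of_le_ne_top hI hle)
  have : IsLocalRing A := .of_surjective' (Ideal.Quotient.mk _) Ideal.Quotient.mk_surjective
  have hA : IsCanonicalModule A A := ⟨injective_quotient_span_singleton (n := n) hx, rfl⟩
  have hRA : Function.Surjective (algebraMap R A) := Ideal.Quotient.mk_surjective
  let rees : ((R ⧸ I) →ₗ[R] A) ≃ₗ[R] OmegaQuot I :=
    LinearEquiv.ofBijective (reesHom hx (R ⧸ I))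
      (bijective_reesHom hx (smul_quotient_eq_zero_of_mem hxI))
  let e : ((R ⧸ I) →ₗ[A] A) ≃ₗ[R] OmegaQuot I :=
    (LinearMap.extendScalarsOfSurjectiveEquiv hRA).symm ≪≫ₗ rees
  exact hA.of_surjective (Ideal.Quotient.factor_surjective hle) (e.extendScalarsOfSurjective hRA)

end OneDimensional

section RigidIdeals

variable {R : Type u} [CommRing R]

theorem bijective_algebraMap_end_of_isPrincipal {I : Ideal R} (hI : I.IsPrincipal) {x : R}
    (hx : x ∈ nonZeroDivisors R) (hxI : x ∈ I) :
    Function.Bijective (algebraMap R (Module.End R I)) := by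
  constructor
  · refine (injective_iff_map_eq_zero _).2 fun r hr => ?_
    have hrx : r * x = 0 := congrArg Subtype.val (LinearMap.congr_fun hr ⟨x, hxI⟩)
    exact (mem_nonZeroDivisors_iff.1 hx).2 r hrx
  · intro φ
    obtain ⟨y, rfl⟩ := hI
    let y' : Submodule.span R {y} := ⟨y, Submodule.mem_span_singleton_self y⟩
    obtain ⟨r, hr⟩ := Submodule.mem_span_singleton.1 (φ y').2
    have hφ : r • y' = φ y' := Subtype.ext hr
    refine ⟨r, LinearMap.ext fun ⟨a, ha⟩ => ?_⟩
    obtain ⟨s, rfl⟩ := Submodule.mem_span_singleton.1 ha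
    change r • s • y' = φ (s • y')
    rw [map_smul, ← hφ, smul_comm]

variable (I : Ideal R)

/-- The connecting homomorphism `Hom(I, R) → Ext¹(R ⧸ I, R)` of `0 → I → R → R ⧸ I → 0`. -/
noncomputable def dualToOmegaQuot : (I →ₗ[R] R) →ₗ[R] OmegaQuot I :=
  contravariantConnecting (LinearMap.exact_subtype_mkQ I) I.injective_subtype I.mkQ_surjective R

theorem surjective_dualToOmegaQuot : Function.Surjective (dualToOmegaQuot I) :=
  surjective_contravariantConnecting R

/-- The map `Hom_R(I, R) → Hom_{R ⧸ I}(I ⧸ I², R ⧸ I)` induced by reduction modulo `I`. -/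
noncomputable def dualToCotangentDual :
    (I →ₗ[R] R) →ₗ[R] (I.Cotangent →ₗ[R ⧸ I] R ⧸ I) where
  toFun φ :=
    let reduction : I.Cotangent →ₗ[R] R ⧸ I :=
      (I • ⊤ : Submodule R I).liftQ (I.mkQ ∘ₗ φ) <| Submodule.smul_le.2 fun r hr a _ => by
        rw [LinearMap.mem_ker, map_smul]
        exact smul_quotient_eq_zero_of_mem hr _
    reduction.extendScalarsOfSurjective Ideal.Quotient.mk_surjective
  map_add' φ ψ := LinearMap.ext <| I.toCotangent_surjective.forall.2 fun _ => rfl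
  map_smul' r φ := LinearMap.ext <| I.toCotangent_surjective.forall.2 fun _ => rfl

variable {I}

theorem dualToCotangentDual_toCotangent (φ : I →ₗ[R] R) (a : I) :
    dualToCotangentDual I φ (I.toCotangent a) = Ideal.Quotient.mk I (φ a) := rfl

theorem surjective_dualToCotangentDual (hrigid : IsRigidModule R I) :
    Function.Surjective (dualToCotangentDual I) := by
  intro θ
  obtain ⟨φ, hφ⟩ := exists_comp_eq_of_subsingleton_ext (LinearMap.exact_subtype_mkQ I)
    I.injective_subtype I.mkQ_surjective hrigid (θ.restrictScalars R ∘ₗ I.toCotangent)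
  exact ⟨φ, LinearMap.ext <| I.toCotangent_surjective.forall.2 (LinearMap.congr_fun hφ)⟩

theorem ker_dualToOmegaQuot_le : (dualToOmegaQuot I).ker ≤ (dualToCotangentDual I).ker := by
  intro φ hφ
  obtain ⟨ψ, rfl⟩ := exists_comp_eq_of_contravariantConnecting_eq_zero hφ
  refine LinearMap.ext <| I.toCotangent_surjective.forall.2 fun a => ?_
  have hψ : ψ a = a * ψ 1 := by rw [← smul_eq_mul, ← map_smul, smul_eq_mul, mul_one]
  rw [dualToCotangentDual_toCotangent, LinearMap.comp_apply, I.subtype_apply, hψ]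
  exact Ideal.Quotient.eq_zero_iff_mem.2 (I.mul_mem_right _ a.2)

theorem HasFreeSummand.length_le {S M : Type u} [CommRing S] [AddCommGroup M] [Module S M]
    (h : HasFreeSummand S M) : Module.length S S ≤ Module.length S M := by
  obtain ⟨P, _, _, ⟨e⟩⟩ := h
  exact e.length_eq.symm.trans_le (Module.length_le_of_injective P.subtype P.subtype_injective)

instance finite_cotangent [IsNoetherianRing R] : Module.Finite (R ⧸ I) I.Cotangent :=
  have : Module.Finite R I.Cotangent := .of_surjective I.toCotangent I.toCotangent_surjective
  .of_restrictScalars_finite R _ _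

theorem isPrincipal_of_isRigidModule_of_length_le [IsLocalRing R] [IsNoetherianRing R]
    [IsLocalRing (R ⧸ I)] [IsArtinianRing (R ⧸ I)] (hrigid : IsRigidModule R I)
    (hω : IsCanonicalModule (R ⧸ I) (OmegaQuot I))
    (hle : Module.length (R ⧸ I) (R ⧸ I) ≤
      Module.length (R ⧸ I) (I.Cotangent →ₗ[R ⧸ I] R ⧸ I)) :
    I.IsPrincipal := by
  have hR : Function.Surjective (algebraMap R (R ⧸ I)) := Ideal.Quotient.mk_surjective
  obtain ⟨e⟩ := nonempty_linearEquiv_of_ker_le_of_length_le (surjective_dualToOmegaQuot I)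
    (surjective_dualToCotangentDual hrigid) ker_dualToOmegaQuot_le
    (isFiniteLength_restrictScalars hR hω.isFiniteLength) (by
      rwa [Module.length_eq_of_surjective hR, Module.length_eq_of_surjective hR, hω.length_eq])
  let e' : OmegaQuot I ≃ₗ[R ⧸ I] (I.Cotangent →ₗ[R ⧸ I] R ⧸ I) := e.extendScalarsOfSurjective hR
  exact isPrincipal_of_isPrincipal_top_cotangent (IsNoetherian.noetherian I)
    (Ideal.Quotient.nontrivial_iff.1 inferInstance)
    (hω.isPrincipal_top_of_injective (f := e'.symm.toLinearMap) e'.symm.injective)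

end RigidIdeals

theorem corollary5p2 {R : Type u} [CommRing R] [IsGorensteinLocalRing R]
    (hdim : ringKrullDim R = 1) (I : Ideal R)
    (hreg : ∃ x ∈ I, x ∈ nonZeroDivisors R) (hrigid : IsRigidModule R I) :
    (Module.length R (R ⧸ I) ≤ Module.length R (TwistedConormal I) →
      Function.Bijective (algebraMap R (Module.End R I)) ∧ I.IsPrincipal) ∧
    (HasFreeSummand (R ⧸ I) (I.Cotangent →ₗ[R ⧸ I] R ⧸ I) →
      Function.Bijective (algebraMap R (Module.End R I)) ∧ I.IsPrincipal) := by
  obtain ⟨x, hxI, hx⟩ := hreg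
  have conclusion (hI : I.IsPrincipal) :
      Function.Bijective (algebraMap R (Module.End R I)) ∧ I.IsPrincipal :=
    ⟨bijective_algebraMap_end_of_isPrincipal hI hx hxI, hI⟩
  rcases eq_or_ne I ⊤ with rfl | hI
  · exact ⟨fun _ => conclusion top_isPrincipal, fun _ => conclusion top_isPrincipal⟩
  obtain ⟨n, _⟩ := IsGorensteinLocalRing.exists_hasInjectiveDimensionLE (R := R)
  have : IsArtinianRing (R ⧸ Ideal.span {x}) := isArtinianRing_quotient_span_singleton hdim.le hx
  have : Nontrivial (R ⧸ I) := Ideal.Quotient.nontrivial_iff.2 hI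
  have : IsLocalRing (R ⧸ I) := .of_surjective' _ Ideal.Quotient.mk_surjective
  have : IsArtinianRing (R ⧸ I) :=
    (Ideal.Quotient.factor_surjective ((Ideal.span_singleton_le_iff_mem I).2 hxI)).isArtinianRing
  have hω := isCanonicalModule_omegaQuot (n := n + 1) hx hxI hI
  refine ⟨fun hle => conclusion ?_, fun hfree => conclusion ?_⟩
  · have hR : Function.Surjective (algebraMap R (R ⧸ I)) := Ideal.Quotient.mk_surjective
    rw [Module.length_eq_of_surjective hR, Module.length_eq_of_surjective hR,
      ← hω.length_linearMap_self] at hle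
    exact isPrincipal_of_isRigidModule_of_length_le hrigid hω hle
  · exact isPrincipal_of_isRigidModule_of_length_le hrigid hω hfree.length_le
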